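/- Let $(R,\mathfrak m)$ be a local noetherian integral domain with field of fractions $K$ (and residue field $k=R/\mathfrak m$), and let $E$ be an injective hull of the $R$-module $k$. For an $R$-module $M$ write $M^\circ=\operatorname{Hom}_R(M,E)$ for its Matlis dual and $\operatorname{Rank}(M)=\dim_K(K\otimes_R M)$, a cardinal number. If $M$ is an injective $R$-module with $\operatorname{Rank}(M)=\operatorname{Rank}(M^{\circ\circ})$, then $M$ is (Matlis-)reflexive, that is, the canonical map $M\to M^{\circ\circ}$, $x\mapsto(f\mapsto f(x))$, is an isomorphism. -/

import Mathlib

open scoped TensorProduct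

universe u v w

namespace Matlis

/-- `ι : N → E` is an injective hull of `N`: `E` is an injective `R`-module, `ι` is injective, and
`E` is an essential extension of the image of `ι`. -/
structure IsInjectiveHull {R N E : Type*} [CommRing R] [AddCommGroup N] [Module R N]
    [AddCommGroup E] [Module R E] (ι : N →ₗ[R] E) : Prop where
  injective_module : Module.Injective R E
  injective_map : Function.Injective ι
  essential : ∀ U : Submodule R E, U ⊓ LinearMap.range ι = ⊥ → U = ⊥

/-- The dual `Hom_R(M, E)` of `M` with respect to `E`. It is the Matlis dual when `R` is local and
`E` is an injective hull of the residue field. -/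
abbrev Dual (R M E : Type*) [CommRing R] [AddCommGroup M] [Module R M]
    [AddCommGroup E] [Module R E] : Type _ :=
  M →ₗ[R] E

/-- The canonical map `M → Hom_R(Hom_R(M, E), E)`, sending `x` to `f ↦ f x`. -/
def eval (R M E : Type*) [CommRing R] [AddCommGroup M] [Module R M]
    [AddCommGroup E] [Module R E] : M →ₗ[R] Dual R (Dual R M E) E :=
  (LinearMap.id : (M →ₗ[R] E) →ₗ[R] (M →ₗ[R] E)).flip

theorem eval_apply {R M E : Type*} [CommRing R] [AddCommGroup M] [Module R M]
    [AddCommGroup E] [Module R E] (x : M) (f : Dual R M E) : eval R M E x f = f x :=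
  rfl

/-- `M` is reflexive with respect to `E`: the canonical map to the bidual is an isomorphism. -/
def IsReflexive (R M E : Type*) [CommRing R] [AddCommGroup M] [Module R M]
    [AddCommGroup E] [Module R E] : Prop :=
  Function.Bijective (eval R M E)

/-- The rank of a module over a domain `R` with field of fractions `K`: the cardinal
`dim_K (K ⊗[R] M)`. -/
noncomputable def rank (R M : Type*) [CommRing R] [IsDomain R] [AddCommGroup M] [Module R M] :
    Cardinal :=
  Module.rank (FractionRing R) (FractionRing R ⊗[R] M)

end Matlis

/-!
Write `M°` for `Hom_R(M, E)`, `𝔪` for the maximal ideal and `K` for the field of fractions of `R`.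
As `E` is an injective cogenerator, the evaluation `M → M°°` is injective, and it splits because
`M` is injective. The rank is additive, so everything depends on the complement of `M` in `M°°`.

*The rank is finite.* As `M` is divisible, it maps onto `V = K ⊗ M`. Composing functionals with a
nonzero map `K → E` embeds `ι → K` into `V°` when `V` has a basis indexed by `ι`. Doing this twice
and using the Erdős–Kaplansky theorem, the rank of `M°°` is larger than that of `M` when the latter
is infinite (`Matlis.IsSocleGenerator.lift_rank_lt_rank_bidual`).

*Reduction to torsion modules.* Hence the rank of `M` is finite, and the cokernel of `M → M°°` is
torsion. An element of the complement killed by `x ≠ 0` comes from `B°°`, where `B` is the `x`-power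
torsion of `M`. By the Artin–Rees lemma `B` is injective, and `B°°` is torsion. So it suffices that
such a `B` is reflexive (`Matlis.IsSocleGenerator.eval_surjective_of_powTorsion`).

*A torsion dual forces finite rank.* Any family of ideals of `R` has a countable subfamily with the
same intersection (`Matlis.exists_nat_iInf_le`), so some sequence in `E` has zero annihilator. A
module with an infinite linearly independent family therefore has a dual that is not torsion
(`Matlis.IsSocleGenerator.exists_smul_ne_zero`), and `B°` has finite rank when `B°°` is torsion.

*Torsion modules.* Finite rank of `B°` first implies that the socle of `B` is finite-dimensional,
hence equal to the socle of `B°°`. A complement `X` of `B` in `B°°` is thus a divisible module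
without socle. If it contained `f ≠ 0`, some `s ∈ 𝔪` would not be nilpotent on `f`. Since `E` is
artinian, for each `f ∈ X` the images `s ^ c f(B°)` become stationary, and by divisibility of `X`
the elements of `E` in such stable images have zero annihilator; countably many of them do. From
these one builds infinitely many linearly independent elements of `B°` as infinite sums
`∑ y i • a i`, in which each `y i` divides the next, every element of `B` is killed by some `y i`,
and the `a i` are chosen one after another (`Matlis.exists_linearIndependent_dual`). This is a contradiction, so
`X = 0` (`Matlis.IsSocleGenerator.eq_bot_of_divisible`) and `B` is reflexive.
-/

open IsLocalRing

namespace Matlis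

/-! ### Injective modules over a domain -/

section Baer

variable {R : Type*} [CommRing R] {Q N : Type*} [AddCommGroup Q] [Module R Q]
  [AddCommGroup N] [Module R N]

theorem Baer.exists_smul_eq [IsDomain R] (hQ : Module.Baer R Q) {r : R} (hr : r ≠ 0) (q : Q) :
    ∃ q', r • q' = q := by
  obtain ⟨h, hh⟩ := hQ.extension_property (LinearMap.mulLeft R r)
    (fun a b hab => mul_left_cancel₀ hr hab) (LinearMap.toSpanSingleton R Q q)
  refine ⟨h 1, ?_⟩
  have := LinearMap.congr_fun hh 1
  simpa [← map_smul] using this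

/-- A map that kills the kernel of `g` factors through `g`, up to extending from the image. -/
theorem Baer.exists_comp_eq (hQ : Module.Baer R Q) {P : Type*} [AddCommGroup P] [Module R P]
    (g : N →ₗ[R] P) (a : N →ₗ[R] Q) (ha : LinearMap.ker g ≤ LinearMap.ker a) :
    ∃ b : P →ₗ[R] Q, b ∘ₗ g = a := by
  obtain ⟨b, hb⟩ := hQ.extension_property ((LinearMap.ker g).liftQ g le_rfl)
    (LinearMap.ker_eq_bot.mp (Submodule.ker_liftQ_eq_bot _ _ _ le_rfl))
    ((LinearMap.ker g).liftQ a ha)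
  refine ⟨b, ?_⟩
  ext n
  simpa using LinearMap.congr_fun hb (Submodule.Quotient.mk n)

theorem Baer.exists_extend (hQ : Module.Baer R Q) (U : Submodule R N) (a : U →ₗ[R] Q) :
    ∃ b : N →ₗ[R] Q, ∀ n (hn : n ∈ U), b n = a ⟨n, hn⟩ := by
  obtain ⟨b, hb⟩ := hQ.extension_property U.subtype U.injective_subtype a
  exact ⟨b, fun n hn => LinearMap.congr_fun hb ⟨n, hn⟩⟩

/-- A map on a divisible module that kills the `r`-torsion is divisible by `r`. -/
theorem exists_smul_eq_of_vanish (hdiv : ∀ r : R, r ≠ 0 → ∀ b : N, ∃ b', r • b' = b) {r : R}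
    (hr : r ≠ 0) (a : N →ₗ[R] Q) (ha : ∀ b : N, r • b = 0 → a b = 0) :
    ∃ a' : N →ₗ[R] Q, r • a' = a := by
  choose d hd using hdiv r hr
  have key : ∀ b c, r • c = b → a (d b) = a c := fun b c hc => by
    rw [← sub_eq_zero, ← map_sub]
    apply ha
    rw [smul_sub, hd, hc, sub_self]
  refine ⟨{ toFun := fun b => a (d b), map_add' := fun b c => ?_, map_smul' := fun s b => ?_ }, ?_⟩
  · rw [← map_add]
    exact key _ _ (by rw [smul_add, hd, hd])
  · rw [RingHom.id_apply, ← map_smul]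
    exact key _ _ (by rw [smul_comm, hd])
  · ext b
    change r • a (d b) = a b
    rw [← map_smul, hd]

/-- The dual of a divisible module is torsion-free. -/
theorem dual_smul_eq_zero (hdiv : ∀ r : R, r ≠ 0 → ∀ b : N, ∃ b', r • b' = b) {r : R}
    (hr : r ≠ 0) (a : N →ₗ[R] Q) (ha : r • a = 0) : a = 0 := by
  ext b
  obtain ⟨b', rfl⟩ := hdiv r hr b
  simpa using LinearMap.congr_fun ha b'

/-- The dual of a torsion-free module with values in an injective module is divisible. -/
theorem Baer.dual_exists_smul_eq (hQ : Module.Baer R Q)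
    (htf : ∀ r : R, r ≠ 0 → ∀ n : N, r • n = 0 → n = 0) {r : R} (hr : r ≠ 0) (a : N →ₗ[R] Q) :
    ∃ a' : N →ₗ[R] Q, r • a' = a := by
  obtain ⟨a', ha'⟩ := hQ.extension_property (r • (LinearMap.id : N →ₗ[R] N))
    ((injective_iff_map_eq_zero _).mpr fun n hn => htf r hr n (by simpa using hn)) a
  refine ⟨a', ?_⟩
  rw [← ha']
  ext n
  simp

theorem Baer.bidual_exists_smul_eq (hQ : Module.Baer R Q)
    (hdiv : ∀ r : R, r ≠ 0 → ∀ b : N, ∃ b', r • b' = b) {r : R} (hr : r ≠ 0)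
    (f : Dual R (Dual R N Q) Q) : ∃ f', r • f' = f :=
  Baer.dual_exists_smul_eq hQ (fun _ hs a ha => dual_smul_eq_zero hdiv hs a ha) hr f

/-- For a finitely generated ideal `I`, a map into an injective module that vanishes on the
`I`-torsion is a combination of maps with coefficients in `I`. -/
theorem Baer.mem_smul_top_of_vanish (hQ : Module.Baer R Q) {I : Ideal R} (hI : I.FG)
    (a : N →ₗ[R] Q) (ha : ∀ n : N, (∀ r ∈ I, r • n = 0) → a n = 0) :
    a ∈ I • (⊤ : Submodule R (N →ₗ[R] Q)) := by
  classical
  obtain ⟨S, rfl⟩ := hI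
  let g : N →ₗ[R] (S → N) := LinearMap.pi fun s => (s : R) • LinearMap.id
  obtain ⟨b, hb⟩ := Baer.exists_comp_eq hQ g a (by
    intro n hn
    refine ha n fun r hr => ?_
    have hS : ∀ s ∈ S, s • n = 0 := fun s hs => by
      simpa [g] using congr_fun (LinearMap.mem_ker.mp hn) ⟨s, hs⟩
    refine Submodule.span_induction (p := fun r _ => r • n = 0) hS (zero_smul R n) ?_ ?_ hr
    · intro x y _ _ hx hy
      rw [add_smul, hx, hy, add_zero]
    · intro c x _ hx
      rw [smul_assoc, hx, smul_zero])
  have : a = ∑ s : S, (s : R) • (b ∘ₗ LinearMap.single R (fun _ : S => N) s) := by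
    rw [← hb]
    ext n
    simp only [LinearMap.comp_apply, LinearMap.sum_apply, LinearMap.smul_apply]
    rw [← LinearMap.sum_single_apply (φ := fun _ : S => N) (g n), map_sum]
    refine Finset.sum_congr rfl fun s _ => ?_
    rw [← map_smul, ← map_smul]
    rfl
  rw [this]
  exact Submodule.sum_mem _ fun s _ =>
    Submodule.smul_mem_smul (Ideal.subset_span s.2) Submodule.mem_top

/-- The `x`-power torsion of an injective module over a noetherian ring is injective. -/
theorem Baer.powTorsion [IsNoetherianRing R] (hQ : Module.Baer R Q) (x : R) (T : Submodule R Q)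
    (hT : ∀ q, q ∈ T ↔ ∃ n : ℕ, x ^ n • q = 0) : Module.Baer R T := by
  intro I g
  -- some power of `x` kills `g`, and by Artin–Rees `g` vanishes on `I ⊓ (x ^ n)` for large `n`
  obtain ⟨k, hk⟩ : ∃ k : ℕ, x ^ k • g = 0 := by
    obtain ⟨S, hS⟩ := IsNoetherian.noetherian (⊤ : Submodule R I)
    choose n hn using fun i : I => (hT (g i)).mp (g i).2
    refine ⟨S.sup n, LinearMap.ext_on (s := (S : Set I)) hS fun i hi => ?_⟩
    obtain ⟨d, hd⟩ := Nat.exists_eq_add_of_le (Finset.le_sup (f := n) hi)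
    apply Subtype.ext
    change x ^ S.sup n • (g i : Q) = 0
    rw [hd, add_comm, pow_add, mul_smul, hn, smul_zero]
  obtain ⟨c, hc⟩ := Ideal.exists_pow_inf_eq_pow_smul (M := R) (Ideal.span {x}) I
  have hvan : ∀ r (hr : r ∈ I), r ∈ Ideal.span {x ^ (k + c)} → g ⟨r, hr⟩ = 0 := by
    intro r hr hrx
    have h1 : r ∈ Ideal.span {x} ^ k • (I : Submodule R R) := by
      have := (hc (k + c) (by omega)).le (x := r) ⟨by
        rwa [Ideal.span_singleton_pow, smul_eq_mul, Ideal.mul_top], hr⟩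
      rw [Nat.add_sub_cancel] at this
      exact Submodule.smul_mono le_rfl inf_le_right this
    rw [Ideal.span_singleton_pow, smul_eq_mul, Ideal.mem_span_singleton_mul] at h1
    obtain ⟨z, hz, rfl⟩ := h1
    rw [show (⟨x ^ k * z, hr⟩ : I) = x ^ k • ⟨z, hz⟩ from rfl, map_smul]
    exact LinearMap.congr_fun hk ⟨z, hz⟩
  let J : Ideal R := Ideal.span {x ^ (k + c)}
  obtain ⟨h, hh⟩ := Baer.exists_comp_eq hQ ((J.mkQ).comp (I.subtype)) (T.subtype ∘ₗ g) (by
    rintro ⟨r, hr⟩ hr'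
    simp only [LinearMap.mem_ker, LinearMap.comp_apply, Submodule.subtype_apply,
      Submodule.mkQ_apply, Submodule.Quotient.mk_eq_zero] at hr' ⊢
    rw [hvan r hr hr', Submodule.coe_zero])
  have hmem : ∀ r, h (J.mkQ r) ∈ T := fun r => (hT _).mpr ⟨k + c, by
    rw [← map_smul, ← map_smul, Submodule.mkQ_apply, (Submodule.Quotient.mk_eq_zero _).mpr,
      map_zero]
    exact Ideal.mul_mem_right _ _ (Ideal.mem_span_singleton_self _)⟩
  exact ⟨(h ∘ₗ J.mkQ).codRestrict T hmem, fun r hr => Subtype.ext (LinearMap.congr_fun hh ⟨r, hr⟩)⟩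

end Baer

/-! ### Artinian modules -/

/-- A module on which `x` is locally nilpotent is artinian as soon as its `x`-torsion is: a
decreasing sequence `W i` is controlled by the submodules `x ^ n (W i ∩ ker x ^ (n + 1))` of the
`x`-torsion, which decrease in both `i` and `n`. -/
theorem isArtinian_of_torsionBy {R N : Type*} [CommRing R] [AddCommGroup N] [Module R N] (x : R)
    (hx : ∀ a : N, ∃ n : ℕ, x ^ n • a = 0) (hN : IsArtinian R (Submodule.torsionBy R N x)) :
    IsArtinian R N := by
  rw [← monotone_stabilizes_iff_artinian]
  intro W
  have hW : ∀ {i j a}, i ≤ j → a ∈ (OrderDual.ofDual (W j) : Submodule R N) →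
    a ∈ (OrderDual.ofDual (W i) : Submodule R N) := fun hij ha => W.monotone hij ha
  let U : ℕ → ℕ → Submodule R (Submodule.torsionBy R N x) := fun i n =>
    { carrier := {e | ∃ a ∈ (OrderDual.ofDual (W i) : Submodule R N), x ^ n • a = (e : N)}
      add_mem' := by
        rintro _ _ ⟨a, ha, h⟩ ⟨a', ha', h'⟩
        exact ⟨a + a', add_mem ha ha', by simp [h, h']⟩
      zero_mem' := ⟨0, zero_mem _, by simp⟩
      smul_mem' := by
        rintro r _ ⟨a, ha, h⟩
        exact ⟨r • a, Submodule.smul_mem _ r ha, by rw [smul_comm, h]; rfl⟩ }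
  have hU : ∀ {i j n k}, i ≤ j → n ≤ k → U j k ≤ U i n := by
    rintro i j n k hij hnk e ⟨a, ha, h⟩
    refine ⟨x ^ (k - n) • a, Submodule.smul_mem _ _ (hW hij ha), ?_⟩
    rw [← h, ← mul_smul, ← pow_add, Nat.add_sub_cancel' hnk]
  obtain ⟨N₀, hN₀⟩ := IsArtinian.monotone_stabilizes
    (⟨fun i => OrderDual.toDual (U i i), fun i j hij => hU hij hij⟩ :
      ℕ →o (Submodule R (Submodule.torsionBy R N x))ᵒᵈ)
  have hrow : ∀ n, ∃ m, ∀ i, m ≤ i → U m n = U i n := fun n => IsArtinian.monotone_stabilizes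
    (⟨fun i => OrderDual.toDual (U i n), fun i j hij => hU hij le_rfl⟩ :
      ℕ →o (Submodule R (Submodule.torsionBy R N x))ᵒᵈ)
  choose m hm using hrow
  let L := max N₀ ((Finset.range N₀).sup m)
  have hL : ∀ i n, L ≤ i → U L n ≤ U i n := by
    intro i n hi
    rcases lt_or_ge n N₀ with hn | hn
    · have h1 : m n ≤ L := (Finset.le_sup (Finset.mem_range.mpr hn)).trans (le_max_right _ _)
      rw [← hm n L h1, hm n i (h1.trans hi)]
    · have h1 : U N₀ N₀ = U (max i n) (max i n) := hN₀ (max i n) (hn.trans (le_max_right _ _))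
      calc U L n ≤ U N₀ N₀ := hU (le_max_left _ _) hn
        _ = U (max i n) (max i n) := h1
        _ ≤ U i n := hU (le_max_left _ _) (le_max_right _ _)
  refine ⟨L, fun i hi => le_antisymm (W.monotone hi) ?_⟩
  suffices ∀ n a, a ∈ (OrderDual.ofDual (W L) : Submodule R N) → x ^ n • a = 0 →
      a ∈ (OrderDual.ofDual (W i) : Submodule R N) from fun a ha =>
    let ⟨n, hn⟩ := hx a
    this n a ha hn
  intro n
  induction n with
  | zero =>
    intro a _ h
    rw [pow_zero, one_smul] at h
    rw [h]
    exact zero_mem _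
  | succ n ih =>
    intro a ha h
    have hmem : x ^ n • a ∈ Submodule.torsionBy R N x := by
      rw [Submodule.mem_torsionBy_iff, ← mul_smul, ← pow_succ', h]
    obtain ⟨a', ha', h'⟩ := hL i n hi (show (⟨x ^ n • a, hmem⟩ : Submodule.torsionBy R N x) ∈ U L n
      from ⟨a, ha, rfl⟩)
    have := ih (a - a') (sub_mem ha (hW hi ha')) (by rw [smul_sub, h', sub_self])
    simpa using add_mem this ha'

/-! ### Intersections of ideals in a noetherian local ring -/

theorem iInf_sup_pow_maximalIdeal {R : Type*} [CommRing R] [IsLocalRing R] [IsNoetherianRing R]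
    (J : Ideal R) : ⨅ n : ℕ, (J ⊔ maximalIdeal R ^ n) = J := by
  refine le_antisymm (fun r hr => ?_) (le_iInf fun n => le_sup_left)
  rw [← Ideal.Quotient.eq_zero_iff_mem]
  have h := Ideal.iInf_pow_smul_eq_bot_of_isLocalRing (M := R ⧸ J) (maximalIdeal R)
    Ideal.IsPrime.ne_top'
  rw [← Submodule.mem_bot R, ← h, Submodule.mem_iInf]
  intro n
  obtain ⟨a, ha, b, hb, rfl⟩ := Submodule.mem_sup.mp ((Submodule.mem_iInf _).mp hr n)
  rw [map_add, Ideal.Quotient.eq_zero_iff_mem.mpr ha, zero_add]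
  have : Ideal.Quotient.mk J b = b • (1 : R ⧸ J) := by
    rw [Algebra.smul_def, mul_one]
    rfl
  rw [this]
  exact Submodule.smul_mem_smul hb Submodule.mem_top

theorem isArtinianRing_quotient_pow_maximalIdeal {R : Type*} [CommRing R] [IsLocalRing R]
    [IsNoetherianRing R] (n : ℕ) : IsArtinianRing (R ⧸ maximalIdeal R ^ n) := by
  rcases Nat.eq_zero_or_pos n with rfl | hn
  · have : Subsingleton (R ⧸ maximalIdeal R ^ 0) := by
      rw [pow_zero, Ideal.one_eq_top]
      exact Ideal.Quotient.subsingleton_iff.mpr rfl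
    infer_instance
  have : Nontrivial (R ⧸ maximalIdeal R ^ n) := Ideal.Quotient.nontrivial_iff.mpr
    (ne_top_of_le_ne_top Ideal.IsPrime.ne_top' (Ideal.pow_le_self hn.ne'))
  have : Ring.KrullDimLE 0 (R ⧸ maximalIdeal R ^ n) := by
    rw [Ring.krullDimLE_zero_iff]
    intro P hP
    have hc : (P.comap (Ideal.Quotient.mk (maximalIdeal R ^ n))).IsPrime := inferInstance
    have hle : maximalIdeal R ≤ P.comap (Ideal.Quotient.mk (maximalIdeal R ^ n)) := by
      refine hc.le_of_pow_le (n := n) fun r hr => ?_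
      rw [Ideal.mem_comap, Ideal.Quotient.eq_zero_iff_mem.mpr hr]
      exact zero_mem _
    have hmax : (P.comap (Ideal.Quotient.mk (maximalIdeal R ^ n))).IsMaximal := by
      rw [← (maximalIdeal.isMaximal R).eq_of_le hc.ne_top hle]
      infer_instance
    rw [← Ideal.map_comap_of_surjective _ Ideal.Quotient.mk_surjective P]
    refine (Ideal.map_eq_top_or_isMaximal_of_surjective _ Ideal.Quotient.mk_surjective
      hmax).resolve_left ?_
    rw [Ideal.map_comap_of_surjective _ Ideal.Quotient.mk_surjective]
    exact hP.ne_top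
  exact IsNoetherianRing.isArtinianRing_of_krullDimLE_zero

/-- In a noetherian local ring every intersection of ideals is already the intersection of
countably many of them: modulo each power of the maximal ideal a countable intersection can be
chosen minimal, and Krull's intersection theorem shows that nothing is left to remove. -/
theorem exists_nat_iInf_le {R : Type*} [CommRing R] [IsLocalRing R] [IsNoetherianRing R]
    {ι : Type*} [Nonempty ι] (J : ι → Ideal R) : ∃ u : ℕ → ι, ⨅ k, J (u k) ≤ ⨅ i, J i := by
  have hmin : ∀ n : ℕ, ∃ u : ℕ → ι, ∀ u' : ℕ → ι, (⨅ k, J (u' k)) ≤ ⨅ k, J (u k) →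
      (⨅ k, J (u k)) ≤ (⨅ k, J (u' k)) ⊔ maximalIdeal R ^ n := by
    intro n
    have := isArtinianRing_quotient_pow_maximalIdeal (R := R) n
    obtain ⟨u, hu⟩ := WellFounded.has_min (wellFounded_lt (α := Ideal (R ⧸ maximalIdeal R ^ n)))
      (Set.range fun u : ℕ → ι => (⨅ k, J (u k)).map (Ideal.Quotient.mk (maximalIdeal R ^ n)))
      (Set.range_nonempty _)
    obtain ⟨⟨u, rfl⟩, hu⟩ := hu
    refine ⟨u, fun u' hu' => ?_⟩
    have h1 := (Ideal.map_mono (f := Ideal.Quotient.mk (maximalIdeal R ^ n)) hu').eq_of_not_lt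
      (hu _ ⟨u', rfl⟩)
    have h2 := Ideal.le_comap_of_map_le h1.symm.le
    rwa [Ideal.comap_map_of_surjective _ Ideal.Quotient.mk_surjective,
      ← RingHom.ker_eq_comap_bot, Ideal.mk_ker] at h2
  choose u hu using hmin
  refine ⟨fun k => u k.unpair.1 k.unpair.2, le_iInf fun i => ?_⟩
  set J₀ := ⨅ k : ℕ, J (u k.unpair.1 k.unpair.2) with hJ₀
  have hle : ∀ n, J₀ ≤ ⨅ k, J (u n k) := fun n => le_iInf fun k =>
    (iInf_le _ (Nat.pair n k)).trans_eq (by simp)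
  suffices J₀ ≤ J₀ ⊓ J i from this.trans inf_le_right
  rw [← iInf_sup_pow_maximalIdeal (J₀ ⊓ J i)]
  refine le_iInf fun n => (hle n).trans ?_
  let u' : ℕ → ι := fun k => Nat.casesOn k i fun k => u k.unpair.1 k.unpair.2
  have hu' : ⨅ k, J (u' k) ≤ J₀ ⊓ J i :=
    le_inf (le_iInf fun k => iInf_le (fun k => J (u' k)) (k + 1)) (iInf_le (fun k => J (u' k)) 0)
  exact (hu n u' (hu'.trans (inf_le_left.trans (hle n)))).trans (sup_le_sup_right hu' _)


/-! ### The injective hull of the residue field -/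

section SocleGenerator

variable (R : Type*) [CommRing R] [IsLocalRing R] {E : Type*} [AddCommGroup E] [Module R E]

/-- `ε` generates the simple socle of the injective module `E` over a local ring, and every nonzero
submodule of `E` contains `ε`. This is the form in which the injective hull of the residue field is
used: the element `ε` is the image of `1`. -/
structure IsSocleGenerator (ε : E) : Prop where
  baer : Module.Baer R E
  ne_zero : ε ≠ 0
  smul_eq_zero : ∀ r ∈ maximalIdeal R, r • ε = 0
  exists_smul_eq : ∀ e : E, e ≠ 0 → ∃ r : R, r • e = ε

variable {R} {ε : E}

theorem IsInjectiveHull.isSocleGenerator {R : Type u} [CommRing R] [IsLocalRing R] {E : Type w}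
    [AddCommGroup E] [Module R E] [Small.{w} R] {ι : ResidueField R →ₗ[R] E}
    (hι : IsInjectiveHull ι) : IsSocleGenerator R (ι 1) where
  baer := Module.Baer.of_injective hι.injective_module
  ne_zero h := one_ne_zero (hι.injective_map (h.trans (map_zero ι).symm))
  smul_eq_zero r hr := by
    rw [← map_smul, Algebra.smul_def, mul_one, ResidueField.algebraMap_eq,
      (residue_eq_zero_iff r).mpr hr, map_zero]
  exists_smul_eq e he := by
    have h : Submodule.span R {e} ⊓ LinearMap.range ι ≠ ⊥ := fun h =>
      he (Submodule.span_singleton_eq_bot.mp (hι.essential _ h))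
    obtain ⟨_, ⟨h1, c, rfl⟩, h2⟩ := Submodule.exists_mem_ne_zero_of_ne_bot h
    obtain ⟨r, hr⟩ := Submodule.mem_span_singleton.mp h1
    obtain ⟨d, hd⟩ := residue_surjective c⁻¹
    refine ⟨d * r, ?_⟩
    have hc : c ≠ 0 := fun hc => h2 (by rw [hc, map_zero])
    rw [mul_smul, hr, ← map_smul, Algebra.smul_def, ResidueField.algebraMap_eq, hd,
      inv_mul_cancel₀ hc]

namespace IsSocleGenerator

variable (hε : IsSocleGenerator R ε)
include hε

theorem exists_eq_smul {e : E} (he : ∀ r ∈ maximalIdeal R, r • e = 0) : ∃ c : R, e = c • ε := by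
  by_cases h0 : e = 0
  · exact ⟨0, by rw [h0, zero_smul]⟩
  obtain ⟨r, hr⟩ := hε.exists_smul_eq e h0
  have hu : IsUnit r := by
    by_contra h
    exact hε.ne_zero (hr ▸ he r h)
  obtain ⟨c, hc⟩ := hu.exists_left_inv
  exact ⟨c, by rw [← hr, ← mul_smul, hc, one_smul]⟩

/-- `E` is a cogenerator. -/
theorem exists_apply_eq {N : Type*} [AddCommGroup N] [Module R N] {n : N} (hn : n ≠ 0) :
    ∃ f : N →ₗ[R] E, f n = ε := by
  obtain ⟨f, hf⟩ := Baer.exists_comp_eq hε.baer (LinearMap.toSpanSingleton R N n)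
    (LinearMap.toSpanSingleton R E ε) (by
      intro r hr
      rw [LinearMap.mem_ker, LinearMap.toSpanSingleton_apply] at hr ⊢
      refine hε.smul_eq_zero r fun hu => hn ?_
      exact (hu.smul_eq_zero).mp hr)
  exact ⟨f, by simpa using LinearMap.congr_fun hf 1⟩

theorem exists_apply_eq_of_notMem {N : Type*} [AddCommGroup N] [Module R N] {U : Submodule R N}
    {n : N} (hn : n ∉ U) : ∃ f : N →ₗ[R] E, (∀ y ∈ U, f y = 0) ∧ f n = ε := by
  obtain ⟨f, hf⟩ := hε.exists_apply_eq (n := U.mkQ n) (by simpa using hn)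
  exact ⟨f ∘ₗ U.mkQ, fun y hy => by
    rw [LinearMap.comp_apply, Submodule.mkQ_apply, (Submodule.Quotient.mk_eq_zero U).mpr hy,
      map_zero], hf⟩

theorem eval_injective (N : Type*) [AddCommGroup N] [Module R N] :
    Function.Injective (eval R N E) := by
  refine (injective_iff_map_eq_zero _).mpr fun n hn => ?_
  by_contra h
  obtain ⟨f, hf⟩ := hε.exists_apply_eq h
  exact hε.ne_zero (by rw [← hf, ← eval_apply n f, hn, LinearMap.zero_apply])

theorem eq_zero_of_smul_eq_zero [IsDomain R] {r : R} (hr : ∀ e : E, r • e = 0) : r = 0 := by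
  by_contra h
  obtain ⟨e, he⟩ := Baer.exists_smul_eq hε.baer h ε
  exact hε.ne_zero (he ▸ hr e)

theorem exists_pow_smul_eq_zero [IsNoetherianRing R] {s : R} (hs : s ∈ maximalIdeal R) (e : E) :
    ∃ n : ℕ, s ^ n • e = 0 := by
  -- the annihilators of `s ^ n • e` stabilize, so `s` acts injectively on the multiples of some
  -- `s ^ n • e`, and these cannot contain the socle
  have hmono : Monotone fun n => Ideal.torsionOf R E (s ^ n • e) := monotone_nat_of_le_succ
    fun n r hr => by
      rw [Ideal.mem_torsionOf_iff] at hr ⊢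
      rw [pow_succ', mul_smul, smul_comm, hr, smul_zero]
  obtain ⟨n, hn⟩ := monotone_stabilizes_iff_noetherian.mpr (inferInstance : IsNoetherian R R)
    ⟨_, hmono⟩
  refine ⟨n, ?_⟩
  by_contra h
  obtain ⟨r, hr⟩ := hε.exists_smul_eq _ h
  have h1 : r ∈ Ideal.torsionOf R E (s ^ (n + 1) • e) := by
    rw [Ideal.mem_torsionOf_iff, pow_succ', mul_smul, smul_comm, hr, hε.smul_eq_zero s hs]
  have h2 : Ideal.torsionOf R E (s ^ n • e) = Ideal.torsionOf R E (s ^ (n + 1) • e) :=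
    hn (n + 1) n.le_succ
  rw [← h2, Ideal.mem_torsionOf_iff, hr] at h1
  exact hε.ne_zero h1

end IsSocleGenerator

/-- Iteration of `isArtinian_of_torsionBy` over finitely many ring elements. -/
theorem isArtinian_of_torsionBySet {R : Type*} [CommRing R] (S : Finset R) {N : Type*}
    [AddCommGroup N] [Module R N] (hS : ∀ s ∈ S, ∀ n : N, ∃ k : ℕ, s ^ k • n = 0)
    (hN : IsArtinian R (Submodule.torsionBySet R N (S : Set R))) : IsArtinian R N := by
  classical
  induction S using Finset.induction_on generalizing N with
  | empty =>
    have h : Submodule.torsionBySet R N ((∅ : Finset R) : Set R) = ⊤ := by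
      rw [eq_top_iff]
      intro n _
      simp [Submodule.mem_torsionBySet_iff]
    rw [h] at hN
    exact isArtinian_of_linearEquiv Submodule.topEquiv
  | insert x S hxS ih =>
    refine isArtinian_of_torsionBy x (hS x (Finset.mem_insert_self x S)) (ih ?_ ?_)
    · intro s hs n
      obtain ⟨k, hk⟩ := hS s (Finset.mem_insert_of_mem hs) n
      exact ⟨k, Subtype.ext hk⟩
    · let g : Submodule.torsionBySet R (Submodule.torsionBy R N x) (S : Set R) →ₗ[R] N :=
        (Submodule.torsionBy R N x).subtype ∘ₗ Submodule.subtype _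
      refine isArtinian_of_injective (g.codRestrict
        (Submodule.torsionBySet R N ((insert x S : Finset R) : Set R)) ?_) ?_
      · intro n
        rw [Submodule.mem_torsionBySet_iff]
        rintro ⟨r, hr⟩
        rcases Finset.mem_insert.mp hr with rfl | hr
        · exact n.1.2
        · exact congrArg Subtype.val ((Submodule.mem_torsionBySet_iff _ _).mp n.2 ⟨r, hr⟩)
      · intro n n' h
        exact Subtype.ext (Subtype.ext (congrArg
          (Submodule.torsionBySet R N ((insert x S : Finset R) : Set R)).subtype h))

/-- `E` is artinian: elements of `𝔪` are locally nilpotent on it, and its `𝔪`-torsion is the simple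
socle. -/
theorem IsSocleGenerator.isArtinian [IsNoetherianRing R] (hε : IsSocleGenerator R ε) :
    IsArtinian R E := by
  obtain ⟨S, hS⟩ := IsNoetherian.noetherian (maximalIdeal R)
  have hSm : ∀ s ∈ S, s ∈ maximalIdeal R := fun s hs => hS ▸ Submodule.subset_span hs
  refine isArtinian_of_torsionBySet S (fun s hs => hε.exists_pow_smul_eq_zero (hSm s hs)) ?_
  have hmem : ∀ r : R, r • ε ∈ Submodule.torsionBySet R E (S : Set R) := fun r => by
    rw [Submodule.mem_torsionBySet_iff]
    rintro ⟨s, hs⟩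
    change s • r • ε = 0
    rw [smul_comm, hε.smul_eq_zero s (hSm s hs), smul_zero]
  have : IsSimpleModule R (R ⧸ maximalIdeal R) :=
    isSimpleModule_iff_quot_maximal.mpr ⟨_, maximalIdeal.isMaximal R, ⟨.refl R _⟩⟩
  refine isArtinian_of_surjective (R ⧸ maximalIdeal R)
    ((maximalIdeal R).liftQ ((LinearMap.toSpanSingleton R E ε).codRestrict _ hmem) fun r hr => ?_) ?_
  · exact Subtype.ext (hε.smul_eq_zero r hr)
  · rintro ⟨e, he⟩
    rw [Submodule.torsionBySet_eq_torsionBySet_span, Submodule.mem_torsionBySet_iff] at he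
    obtain ⟨c, rfl⟩ := hε.exists_eq_smul fun r hr =>
      he ⟨r, by rw [← hS] at hr; exact hr⟩
    exact ⟨Submodule.Quotient.mk c, rfl⟩

end SocleGenerator

/-- A nonzero element on which the maximal ideal acts nilpotently has a nonzero multiple in the
socle. -/
theorem exists_smul_mem_socle {R : Type*} [CommRing R] [IsLocalRing R] [IsNoetherianRing R]
    {N : Type*} [AddCommGroup N] [Module R N] {n : N} (hn : n ≠ 0)
    (h : ∀ s ∈ maximalIdeal R, ∃ k : ℕ, s ^ k • n = 0) :
    ∃ r : R, r • n ≠ 0 ∧ ∀ t ∈ maximalIdeal R, t • r • n = 0 := by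
  classical
  have hex : ∃ k, maximalIdeal R ^ k ≤ Ideal.torsionOf R N n :=
    Ideal.exists_pow_le_of_le_radical_of_fg (fun s hs => by
      obtain ⟨k, hk⟩ := h s hs
      exact ⟨k, (Ideal.mem_torsionOf_iff _ _).mpr hk⟩) (IsNoetherian.noetherian _)
  have hspec := Nat.find_spec hex
  obtain ⟨d, hd⟩ : ∃ d, Nat.find hex = d + 1 := by
    refine Nat.exists_eq_succ_of_ne_zero fun h0 => hn ?_
    rw [h0, pow_zero] at hspec
    simpa using hspec (x := 1) (by simp)
  obtain ⟨r, hr, hrn⟩ := Set.not_subset.mp (Nat.find_min hex (m := d) (by omega))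
  refine ⟨r, fun h0 => hrn ((Ideal.mem_torsionOf_iff _ _).mpr h0), fun t ht => ?_⟩
  rw [← mul_smul]
  refine (Ideal.mem_torsionOf_iff _ _).mp (hspec ?_)
  rw [hd, pow_succ']
  exact Ideal.mul_mem_mul ht hr

/-! ### Infinite independent families in a dual -/

section Independent

variable {R : Type*} [CommRing R] {E B : Type*}
  [AddCommGroup E] [Module R E] [AddCommGroup B] [Module R B]

/-- If a module has an infinite linearly independent family, then its dual is not torsion: send
the family to a sequence in `E` with zero annihilator. -/
theorem IsSocleGenerator.exists_smul_ne_zero [IsDomain R] [IsLocalRing R] [IsNoetherianRing R] {ε : E}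
    (hε : IsSocleGenerator R ε) {a : ℕ → B} (ha : LinearIndependent R a) :
    ∃ f : Dual R B E, ∀ r : R, r ≠ 0 → r • f ≠ 0 := by
  obtain ⟨u, hu⟩ := exists_nat_iInf_le fun e : E => Ideal.torsionOf R E e
  obtain ⟨f, hf⟩ := hε.baer.extension_property (Finsupp.linearCombination R a) ha
    (Finsupp.linearCombination R u)
  refine ⟨f, fun r hr h => hr (hε.eq_zero_of_smul_eq_zero fun e => ?_)⟩
  have h1 : r ∈ ⨅ k, Ideal.torsionOf R E (u k) := (Submodule.mem_iInf _).mpr fun k => by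
    have := LinearMap.congr_fun hf (Finsupp.single k 1)
    simp only [LinearMap.comp_apply, Finsupp.linearCombination_single, one_smul] at this
    rw [Ideal.mem_torsionOf_iff, ← this, ← LinearMap.smul_apply, h, LinearMap.zero_apply]
  exact (Submodule.mem_iInf _).mp (hu h1) e

/-- The sum `∑ i, r i • y i • a i` in the dual of `B`, for a sequence `y` each term of which
divides the next and such that every element of `B` is killed by some `y i`. It converges
pointwise. -/
theorem exists_dual_sum (y z : ℕ → R) (hyz : ∀ i, y (i + 1) = y i * z i)
    (hB : ∀ b : B, ∃ i, y i • b = 0) (a : ℕ → Dual R B E) :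
    ∃ C : (ℕ → R) →ₗ[R] Dual R B E, ∀ r n b, y n • b = 0 →
      C r b = ∑ i ∈ Finset.range n, r i • a i (y i • b) := by
  choose N hN using hB
  have hmono : ∀ {n m b}, n ≤ m → y n • b = (0 : B) → y m • b = 0 := by
    intro n m b hnm h
    induction m, hnm using Nat.le_induction with
    | base => exact h
    | succ m _ ih => rw [hyz, mul_comm, mul_smul, ih, smul_zero]
  have key : ∀ (r : ℕ → R) n b, y n • b = 0 → ∑ i ∈ Finset.range (N b), r i • a i (y i • b) =
      ∑ i ∈ Finset.range n, r i • a i (y i • b) := by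
    intro r n b hn
    have hext : ∀ n', y n' • b = 0 → ∑ i ∈ Finset.range n', r i • a i (y i • b) =
        ∑ i ∈ Finset.range (max n' (max n (N b))), r i • a i (y i • b) := fun n' hn' =>
      Finset.sum_subset (Finset.range_mono (le_max_left _ _)) fun i _ hi => by
        rw [hmono (not_lt.mp fun h => hi (Finset.mem_range.mpr h)) hn', map_zero, smul_zero]
    rw [hext _ (hN b), hext _ hn]
    congr 2
    omega
  refine ⟨LinearMap.mk₂ R (fun r b => ∑ i ∈ Finset.range (N b), r i • a i (y i • b))
    ?_ ?_ ?_ ?_, key⟩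
  · intro r r' b
    simp only [Pi.add_apply, add_smul, Finset.sum_add_distrib]
  · intro c r b
    simp only [Pi.smul_apply, smul_eq_mul, mul_smul, Finset.smul_sum]
  · intro r b b'
    let n := max (N b) (N b')
    have h1 : y n • b = 0 := hmono (le_max_left _ _) (hN b)
    have h2 : y n • b' = 0 := hmono (le_max_right _ _) (hN b')
    rw [key r n b h1, key r n b' h2, key r n (b + b') (by rw [smul_add, h1, h2, add_zero])]
    simp only [smul_add, map_add, Finset.sum_add_distrib]
  · intro c r b
    rw [key r (N b) (c • b) (by rw [smul_comm, hN, smul_zero]), Finset.smul_sum]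
    refine Finset.sum_congr rfl fun i _ => ?_
    rw [smul_comm (y i) c b, map_smul, smul_comm]

/-- Recursive construction of a sequence whose `i`-th term satisfies a condition depending on the
earlier terms. -/
theorem exists_seq_of_forall_prefix {α : Type*} [Inhabited α] (P : ℕ → (ℕ → α) → α → Prop)
    (hP : ∀ i g, ∃ x, P i g x)
    (hcongr : ∀ i g g' x, (∀ k < i, g k = g' k) → P i g x → P i g' x) :
    ∃ a : ℕ → α, ∀ i, P i a (a i) := by
  choose next hnext using hP
  let G : ℕ → ℕ → α := fun n => Nat.rec (fun _ => default)
    (fun i g => Function.update g i (next i g)) n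
  have hG : ∀ i, G (i + 1) = Function.update (G i) i (next i (G i)) := fun i => rfl
  have hstab : ∀ k n, k < n → G n k = next k (G k) := by
    intro k n hkn
    induction n, hkn using Nat.le_induction with
    | base => rw [hG, Function.update_self]
    | succ n hn ih => rw [hG, Function.update_of_ne (by omega), ih]
  refine ⟨fun k => next k (G k), fun i => hcongr i (G i) _ _ (fun k hk => hstab k i hk)
    (hnext i (G i))⟩

/-- A criterion for the dual of `B` to have infinite rank. The independent elements are
`∑ y i • a i`, summed over `i` with `j i = k`. Here `a i` is chosen after `a 0, …, a (i - 1)`, with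
a multiple `s ^ c • f i (a i)` still equal to `w i`, where `c` is so large that `s ^ c` kills the
contribution of the previous terms to `f' i := f i / y i`; since `f' i` is killed by `y (i + 1)` it
does not see the later terms. So a relation with coefficients `r` gives `r (j i) • w i = 0`. -/
theorem exists_linearIndependent_dual [IsDomain R] (hE : Module.Baer R E)
    (hdiv : ∀ r : R, r ≠ 0 → ∀ b : B, ∃ b', r • b' = b)
    {s : R} (hs : ∀ e : E, ∃ n : ℕ, s ^ n • e = 0)
    {y z : ℕ → R} (hy : ∀ i, y i ≠ 0) (hyz : ∀ i, y (i + 1) = y i * z i)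
    (hB : ∀ b : B, ∃ i, y i • b = 0)
    {f : ℕ → Dual R (Dual R B E) E} (hz : ∀ i, z i • f i = 0)
    {w : ℕ → E} (hw : ∀ i c, ∃ a, s ^ c • f i a = w i)
    {j : ℕ → ℕ} (hann : ∀ (k : ℕ) (r : R), (∀ i, j i = k → r • w i = 0) → r = 0) :
    ∃ c : ℕ → Dual R B E, LinearIndependent R c := by
  choose f' hf' using fun i => Baer.bidual_exists_smul_eq hE hdiv (hy i) (f i)
  have hpow : ∀ (n : ℕ) (e : ℕ → E), ∃ c : ℕ, ∀ k < n, s ^ c • e k = 0 := by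
    intro n e
    choose c hc using fun k => hs (e k)
    refine ⟨(Finset.range n).sup c, fun k hk => ?_⟩
    obtain ⟨d, hd⟩ := Nat.exists_eq_add_of_le (Finset.le_sup (f := c) (Finset.mem_range.mpr hk))
    rw [hd, add_comm, pow_add, mul_smul, hc, smul_zero]
  obtain ⟨a, ha⟩ := exists_seq_of_forall_prefix
    (fun i (g : ℕ → Dual R B E) x => ∃ c : ℕ, (∀ k < i, s ^ c • f' i (y k • g k) = 0) ∧
      s ^ c • f i x = w i)
    (fun i g => by
      obtain ⟨c, hc⟩ := hpow i fun k => f' i (y k • g k)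
      obtain ⟨x, hx⟩ := hw i c
      exact ⟨x, c, hc, hx⟩)
    (fun i g g' x hg ⟨c, hc, hx⟩ => ⟨c, fun k hk => by rw [← hg k hk]; exact hc k hk, hx⟩)
  obtain ⟨C, hC⟩ := exists_dual_sum y z hyz hB a
  have hC0 : ∀ r : ℕ → R, C (fun i => r (j i)) = 0 → r = 0 := by
    intro r hr
    funext k
    refine hann k _ fun i hi => ?_
    obtain ⟨c, hc, hcw⟩ := ha i
    -- the terms up to `i` add up to minus the tail, which is divisible by `y (i + 1)`
    let D : Dual R B E := ∑ i' ∈ Finset.range (i + 1), r (j i') • y i' • a i'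
    obtain ⟨D', hD'⟩ := exists_smul_eq_of_vanish hdiv (hy (i + 1)) D fun b hb => by
      have h := hC (fun i => r (j i)) (i + 1) b hb
      rw [hr, LinearMap.zero_apply] at h
      rw [h, LinearMap.sum_apply]
      refine Finset.sum_congr rfl fun i' _ => ?_
      rw [LinearMap.smul_apply, LinearMap.smul_apply, map_smul]
    have hD0 : f' i D = 0 := by
      rw [← hD', map_smul, hyz, mul_comm, mul_smul, ← LinearMap.smul_apply (y i), hf',
        ← LinearMap.smul_apply, hz, LinearMap.zero_apply]
    have h1 : s ^ c • f' i D = r (j i) • w i := by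
      simp only [D]
      rw [Finset.sum_range_succ, map_add, map_sum, smul_add, Finset.smul_sum,
        Finset.sum_eq_zero, zero_add]
      · rw [map_smul, map_smul, ← LinearMap.smul_apply (y i), hf', smul_comm, hcw]
      · intro i' hi'
        rw [map_smul, smul_comm, hc i' (Finset.mem_range.mp hi'), smul_zero]
    rw [← hi, ← h1, hD0, smul_zero]
  let L : (ℕ → R) →ₗ[R] Dual R B E := C ∘ₗ LinearMap.funLeft R R j
  have hL : LinearMap.ker L = ⊥ := LinearMap.ker_eq_bot'.mpr fun r hr => hC0 r hr
  exact ⟨_, (Pi.linearIndependent_single_one ℕ R).map' L hL⟩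

end Independent

section Core

variable {R : Type*} [CommRing R] [IsDomain R] [IsLocalRing R] [IsNoetherianRing R] {E B : Type*}
  [AddCommGroup E] [Module R E] [AddCommGroup B] [Module R B]

/-- If the bidual of a divisible `x`-power torsion module is torsion, then it has no nonzero
divisible submodule without socle. -/
theorem IsSocleGenerator.eq_bot_of_divisible {ε : E} (hε : IsSocleGenerator R ε)
    (hdiv : ∀ r : R, r ≠ 0 → ∀ b : B, ∃ b', r • b' = b)
    {x : R} (hx : x ≠ 0) (hxB : ∀ b : B, ∃ n : ℕ, x ^ n • b = 0)
    (htors : ∀ f : Dual R (Dual R B E) E, ∃ r : R, r ≠ 0 ∧ r • f = 0)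
    (X : Submodule R (Dual R (Dual R B E) E))
    (hX : ∀ r : R, r ≠ 0 → ∀ f ∈ X, ∃ f' ∈ X, r • f' = f)
    (hsoc : ∀ f ∈ X, (∀ r ∈ maximalIdeal R, r • f = 0) → f = 0) : X = ⊥ := by
  by_contra hne
  obtain ⟨f₀, hf₀X, hf₀⟩ := Submodule.exists_mem_ne_zero_of_ne_bot hne
  -- since `f₀` generates a submodule without socle, some `s` in the maximal ideal is not nilpotent
  -- on `f₀`
  obtain ⟨s, hsm, hs⟩ : ∃ s ∈ maximalIdeal R, ∀ n : ℕ, s ^ n • f₀ ≠ 0 := by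
    by_contra! h
    obtain ⟨r, hr, hrm⟩ := exists_smul_mem_socle hf₀ h
    exact hr (hsoc _ (X.smul_mem r hf₀X) hrm)
  have := hε.isArtinian
  -- the values that persist in all `s ^ c f(B°)`, for `f` in `X`, have zero annihilator
  let I := {p : Dual R (Dual R B E) E × E // p.1 ∈ X ∧ ∀ c : ℕ, ∃ a, s ^ c • p.1 a = p.2}
  have : Nonempty I := ⟨⟨(f₀, 0), hf₀X, fun c => ⟨0, by simp⟩⟩⟩
  have hI : ⨅ p : I, Ideal.torsionOf R E p.1.2 = ⊥ := by
    rw [eq_bot_iff]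
    intro r hr
    by_contra hr0
    obtain ⟨f, hfX, hf⟩ := hX r hr0 f₀ hf₀X
    let W : ℕ → Submodule R E := fun c => LinearMap.range (s ^ c • f)
    have hW : Antitone W := antitone_nat_of_succ_le fun c => by
      rintro _ ⟨a, rfl⟩
      exact ⟨s • a, by simp [pow_succ, mul_smul, smul_comm s]⟩
    obtain ⟨n, hn⟩ := IsArtinian.monotone_stabilizes
      (⟨fun c => OrderDual.toDual (W c), fun c d h => hW h⟩ : ℕ →o (Submodule R E)ᵒᵈ)
    refine hs n ?_
    ext a
    have hpers : ∀ c, ∃ a', s ^ c • f a' = s ^ n • f a := fun c => by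
      have h1 : W n = W (max c n) := hn (max c n) (le_max_right _ _)
      have h2 : s ^ n • f a ∈ W c := hW (le_max_left c n) (h1 ▸ ⟨a, rfl⟩)
      exact h2
    have h3 := (Submodule.mem_iInf _).mp hr ⟨(f, s ^ n • f a), hfX, hpers⟩
    rw [Ideal.mem_torsionOf_iff] at h3
    rw [← hf, LinearMap.smul_apply, LinearMap.smul_apply, LinearMap.zero_apply, smul_comm]
    exact h3
  -- each member of a countable subfamily is used infinitely often, once for every element of the
  -- independent family; the factor `x` of `z i` makes the products `y i` exhaust `B`
  obtain ⟨p, hp⟩ := exists_nat_iInf_le fun p : I => Ideal.torsionOf R E p.1.2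
  choose t ht0 ht using fun l => htors (p l).1.1
  let z : ℕ → R := fun i => x * t i.unpair.2
  have hz0 : ∀ i, z i ≠ 0 := fun i => mul_ne_zero hx (ht0 _)
  obtain ⟨c, hc⟩ := exists_linearIndependent_dual (j := fun i => i.unpair.1)
    (y := fun i => ∏ k ∈ Finset.range i, z k) (z := z)
    (f := fun i => (p i.unpair.2).1.1) (w := fun i => (p i.unpair.2).1.2) hε.baer hdiv
    (hε.exists_pow_smul_eq_zero hsm) (fun i => Finset.prod_ne_zero_iff.mpr fun k _ => hz0 k)
    (fun i => Finset.prod_range_succ z i)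
    (fun b => by
      obtain ⟨n, hn⟩ := hxB b
      refine ⟨n, ?_⟩
      simp only [z, Finset.prod_mul_distrib, Finset.prod_const, Finset.card_range]
      rw [mul_comm, mul_smul, hn, smul_zero])
    (fun i => by simp only [z]; rw [mul_smul, ht, smul_zero])
    (fun i c => (p i.unpair.2).2.2 c)
    (fun k r hr => by
      rw [← Submodule.mem_bot R, ← hI]
      refine hp ((Submodule.mem_iInf _).mpr fun l => ?_)
      simpa using hr (Nat.pair k l) (by simp))
  obtain ⟨f, hf⟩ := hε.exists_smul_ne_zero hc
  obtain ⟨r, hr, hrf⟩ := htors f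
  exact hf r hr hrf

end Core


/-! ### The socle of the bidual -/

section Socle

variable {R : Type*} [CommRing R] [IsLocalRing R] {E B : Type*}
  [AddCommGroup E] [Module R E] [AddCommGroup B] [Module R B] {ε : E}

/-- A basis of the socle of `B` over the residue field, with elements of the dual of `B` that
extend the dual basis. -/
theorem IsSocleGenerator.exists_socle_basis (hε : IsSocleGenerator R ε) (B : Type v)
    [AddCommGroup B] [Module R B] :
    ∃ (κ : Type v) (t : κ → B) (a : κ → Dual R B E),
      (∀ i, ∀ r ∈ maximalIdeal R, r • t i = 0) ∧ (∀ i, a i (t i) = ε) ∧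
      (∀ i j, i ≠ j → a i (t j) = 0) ∧
      ∀ b : B, (∀ r ∈ maximalIdeal R, r • b = 0) → b ∈ Submodule.span R (Set.range t) := by
  classical
  let _ : Field (R ⧸ maximalIdeal R) := Ideal.Quotient.field _
  let S := Submodule.torsionBySet R B (maximalIdeal R : Set R)
  let c := Module.Basis.ofVectorSpace (R ⧸ maximalIdeal R) S
  let φ : (R ⧸ maximalIdeal R) →ₗ[R] E :=
    (maximalIdeal R).liftQ (LinearMap.toSpanSingleton R E ε) fun r hr => hε.smul_eq_zero r hr
  choose a ha using fun i => Baer.exists_extend hε.baer S (φ ∘ₗ (c.coord i).restrictScalars R)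
  refine ⟨_, fun i => (c i : B), a, ?_, ?_, ?_, ?_⟩
  · exact fun i r hr => (Submodule.mem_torsionBySet_iff _ _).mp (c i).2 ⟨r, hr⟩
  · intro i
    rw [ha i _ (c i).2]
    change φ (c.repr (c i) i) = ε
    rw [Module.Basis.repr_self, Finsupp.single_eq_same]
    exact one_smul R ε
  · intro i j hij
    rw [ha i _ (c j).2]
    change φ (c.repr (c j) i) = 0
    rw [Module.Basis.repr_self, Finsupp.single_eq_of_ne hij, map_zero]
  · intro b hb
    have hbS : b ∈ S := (Submodule.mem_torsionBySet_iff _ _).mpr fun r => hb r r.2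
    have h1 : (⟨b, hbS⟩ : S) ∈ Submodule.span R (Set.range c) := by
      rw [← Submodule.restrictScalars_span R (R ⧸ maximalIdeal R) Ideal.Quotient.mk_surjective,
        c.span_eq]
      trivial
    have h2 := Submodule.mem_map_of_mem (f := S.subtype) h1
    rw [Submodule.map_span, ← Set.range_comp] at h2
    exact h2

/-- For an injective module, elements of the dual that are dual to elements of the socle are
linearly independent: finitely many of them map `B` onto a power of the artinian module `E`, since
they do so after composition with a map from that power to `B` that is the identity on socles. -/
theorem IsSocleGenerator.linearIndependent_of_socle [IsDomain R] [IsNoetherianRing R]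
    (hε : IsSocleGenerator R ε) (hB : Module.Baer R B) {κ : Type*} {t : κ → B} {a : κ → Dual R B E}
    (ht : ∀ i, ∀ r ∈ maximalIdeal R, r • t i = 0) (ha : ∀ i, a i (t i) = ε)
    (ha' : ∀ i j, i ≠ j → a i (t j) = 0) : LinearIndependent R a := by
  classical
  have := hε.isArtinian
  rw [linearIndependent_iff']
  intro s g hg i hi
  choose ψ hψ using fun i => Baer.exists_comp_eq hB (LinearMap.toSpanSingleton R E ε)
    (LinearMap.toSpanSingleton R B (t i)) (fun r hr => by
      rw [LinearMap.mem_ker, LinearMap.toSpanSingleton_apply] at hr ⊢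
      refine ht i r fun hu => hε.ne_zero ?_
      exact (hu.smul_eq_zero).mp hr)
  have hψε : ∀ i, ψ i ε = t i := fun i => by simpa using LinearMap.congr_fun (hψ i) 1
  let φ : B →ₗ[R] (s → E) := LinearMap.pi fun j => a j
  let Ψ : (s → E) →ₗ[R] B := ∑ j : s, ψ j ∘ₗ LinearMap.proj j
  have hid : ∀ c : s → R, φ (Ψ fun j => c j • ε) = fun j => c j • ε := by
    intro c
    funext j
    simp only [φ, Ψ, LinearMap.pi_apply, LinearMap.sum_apply, LinearMap.comp_apply,
      LinearMap.proj_apply, map_smul, hψε, map_sum]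
    rw [Finset.sum_eq_single j, ha]
    · intro j' _ hne
      rw [ha' _ _ fun h => hne (Subtype.ext h.symm), smul_zero]
    · exact fun h => absurd (Finset.mem_univ j) h
  have hinj : Function.Injective (φ ∘ₗ Ψ) := by
    refine (injective_iff_map_eq_zero _).mpr fun p hp => ?_
    by_contra hp0
    obtain ⟨r, hr, hrm⟩ := exists_smul_mem_socle hp0 fun x hx => by
      choose n hn using fun j => hε.exists_pow_smul_eq_zero hx (p j)
      refine ⟨Finset.univ.sup n, funext fun j => ?_⟩
      obtain ⟨d, hd⟩ := Nat.exists_eq_add_of_le (Finset.le_sup (f := n) (Finset.mem_univ j))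
      rw [Pi.smul_apply, hd, add_comm, pow_add, mul_smul, hn, smul_zero, Pi.zero_apply]
    choose c hc using fun j => hε.exists_eq_smul (e := (r • p) j) fun x hx =>
      congr_fun (hrm x hx) j
    have h1 : r • p = fun j => c j • ε := funext hc
    have h2 : (φ ∘ₗ Ψ) (r • p) = r • p := by
      rw [h1]
      exact hid c
    exact hr (by rw [← h2, map_smul, hp, smul_zero])
  refine hε.eq_zero_of_smul_eq_zero fun e => ?_
  obtain ⟨p, hp⟩ := IsArtinian.surjective_of_injective_endomorphism _ hinj (Pi.single ⟨i, hi⟩ e)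
  have h1 := LinearMap.congr_fun hg (Ψ p)
  rw [LinearMap.sum_apply, LinearMap.zero_apply, Finset.sum_eq_single i] at h1
  · have h2 : a i (Ψ p) = e := by
      have := congr_fun hp ⟨i, hi⟩
      rwa [Pi.single_eq_same] at this
    rwa [LinearMap.smul_apply, h2] at h1
  · intro j hj hji
    have h2 : a j (Ψ p) = 0 := by
      have := congr_fun hp ⟨j, hj⟩
      rwa [Pi.single_eq_of_ne fun h => hji (congrArg Subtype.val h)] at this
    rw [LinearMap.smul_apply, h2, smul_zero]
  · exact fun h => absurd hi h

/-- If the bidual of an injective module `B` is torsion, then the socle of `B` is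
finite-dimensional, and therefore the socle of the bidual consists of evaluations. -/
theorem IsSocleGenerator.exists_eval_eq_of_socle [IsDomain R] [IsNoetherianRing R]
    (hε : IsSocleGenerator R ε) (hB : Module.Baer R B)
    (htors : ∀ f : Dual R (Dual R B E) E, ∃ r : R, r ≠ 0 ∧ r • f = 0)
    {g : Dual R (Dual R B E) E} (hg : ∀ r ∈ maximalIdeal R, r • g = 0) :
    ∃ b, eval R B E b = g := by
  classical
  obtain ⟨κ, t, a, ht, ha, ha', hspan⟩ := hε.exists_socle_basis B
  have hli := hε.linearIndependent_of_socle hB ht ha ha'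
  have hfin : Finite κ := by
    by_contra hinf
    rw [not_finite_iff_infinite] at hinf
    obtain ⟨f, hf⟩ := hε.exists_smul_ne_zero
      (hli.comp (Infinite.natEmbedding κ) (Infinite.natEmbedding κ).injective)
    obtain ⟨r, hr, hrf⟩ := htors f
    exact hf r hr hrf
  have := Fintype.ofFinite κ
  choose c hc using fun i => hε.exists_eq_smul (e := g (a i)) fun r hr => by
    rw [← LinearMap.smul_apply, hg r hr, LinearMap.zero_apply]
  refine ⟨∑ i, c i • t i, LinearMap.ext fun a₀ => ?_⟩
  choose γ hγ using fun i => hε.exists_eq_smul (e := a₀ (t i)) fun r hr => by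
    rw [← map_smul, ht i r hr, map_zero]
  have hzero : a₀ - ∑ i, γ i • a i ∈ maximalIdeal R • (⊤ : Submodule R (B →ₗ[R] E)) := by
    refine Baer.mem_smul_top_of_vanish hε.baer (IsNoetherian.noetherian _) _ fun b hb => ?_
    rw [← LinearMap.mem_ker]
    refine Submodule.span_le.mpr ?_ (hspan b hb)
    rintro _ ⟨j, rfl⟩
    rw [SetLike.mem_coe, LinearMap.mem_ker, LinearMap.sub_apply, LinearMap.sum_apply,
      Finset.sum_eq_single j, LinearMap.smul_apply, ha, hγ, sub_self]
    · intro i _ hij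
      rw [LinearMap.smul_apply, ha' i j hij, smul_zero]
    · exact fun h => absurd (Finset.mem_univ j) h
  have hg0 : g (a₀ - ∑ i, γ i • a i) = 0 := by
    refine Submodule.smul_induction_on hzero (fun r hr a' _ => ?_) fun x y hx hy => ?_
    · rw [map_smul, ← LinearMap.smul_apply, hg r hr, LinearMap.zero_apply]
    · rw [map_add, hx, hy, add_zero]
  rw [map_sub, sub_eq_zero] at hg0
  rw [hg0, eval_apply, map_sum, map_sum]
  refine Finset.sum_congr rfl fun i _ => ?_
  rw [map_smul, map_smul, hγ, hc, smul_comm]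

/-- The bidual of an injective module splits off the module. -/
theorem IsSocleGenerator.exists_retraction (hε : IsSocleGenerator R ε) (hB : Module.Baer R B) :
    ∃ ρ : Dual R (Dual R B E) E →ₗ[R] B, ∀ b, ρ (eval R B E b) = b := by
  obtain ⟨ρ, hρ⟩ := hB.extension_property (eval R B E) (hε.eval_injective B) LinearMap.id
  exact ⟨ρ, LinearMap.congr_fun hρ⟩

end Socle

/-! ### Injective modules of finite rank -/

section FiniteRank

variable {R : Type*} [CommRing R] [IsDomain R] [IsLocalRing R] [IsNoetherianRing R] {E B : Type*}
  [AddCommGroup E] [Module R E] [AddCommGroup B] [Module R B] {ε : E}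

/-- An injective `x`-power torsion module with torsion bidual is reflexive: a complement of it in
the bidual is divisible without socle. -/
theorem IsSocleGenerator.eval_surjective_of_powTorsion (hε : IsSocleGenerator R ε)
    (hB : Module.Baer R B) {x : R} (hx : x ≠ 0) (hxB : ∀ b : B, ∃ n : ℕ, x ^ n • b = 0)
    (htors : ∀ f : Dual R (Dual R B E) E, ∃ r : R, r ≠ 0 ∧ r • f = 0) :
    Function.Surjective (eval R B E) := by
  obtain ⟨ρ, hρ⟩ := hε.exists_retraction hB
  have hdiv : ∀ r : R, r ≠ 0 → ∀ b : B, ∃ b', r • b' = b := fun r hr b =>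
    Baer.exists_smul_eq hB hr b
  have hker : ∀ f, f - eval R B E (ρ f) ∈ LinearMap.ker ρ := fun f => by
    rw [LinearMap.mem_ker, map_sub, hρ, sub_self]
  have hX : LinearMap.ker ρ = ⊥ := by
    refine hε.eq_bot_of_divisible hdiv hx hxB htors _ (fun r hr f hf => ?_) fun f hf hfm => ?_
    · obtain ⟨f', rfl⟩ := Baer.bidual_exists_smul_eq hε.baer hdiv hr f
      refine ⟨f' - eval R B E (ρ f'), hker f', ?_⟩
      rw [smul_sub, ← map_smul, ← map_smul, LinearMap.mem_ker.mp hf, map_zero, sub_zero]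
    · obtain ⟨b, rfl⟩ := hε.exists_eval_eq_of_socle hB htors hfm
      rw [LinearMap.mem_ker, hρ] at hf
      rw [hf, map_zero]
  intro f
  have h := hker f
  rw [hX, Submodule.mem_bot, sub_eq_zero] at h
  exact ⟨ρ f, h.symm⟩

/-- An injective module `M` is reflexive if the cokernel of `M → M°°` is torsion: the `x`-torsion
of `M°°` comes from the bidual of the `x`-power torsion of `M`. -/
theorem IsSocleGenerator.eval_surjective_of_torsion_cokernel (hε : IsSocleGenerator R ε)
    (hB : Module.Baer R B)
    (htors : ∀ f : Dual R (Dual R B E) E, ∃ r : R, r ≠ 0 ∧ ∃ b, eval R B E b = r • f) :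
    Function.Surjective (eval R B E) := by
  obtain ⟨ρ, hρ⟩ := hε.exists_retraction hB
  suffices ∀ f, ρ f = 0 → f = 0 from fun f =>
    ⟨ρ f, (sub_eq_zero.mp (this (f - eval R B E (ρ f)) (by rw [map_sub, hρ, sub_self]))).symm⟩
  intro f hf
  obtain ⟨x, hx, b, hb⟩ := htors f
  have hxf : x • f = 0 := by
    have h := hρ b
    rw [hb, map_smul, hf, smul_zero] at h
    rw [← hb, ← h, map_zero]
  let T : Submodule R B :=
    { carrier := {q | ∃ n : ℕ, x ^ n • q = 0}
      add_mem' := by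
        rintro q q' ⟨n, hn⟩ ⟨n', hn'⟩
        exact ⟨n + n', by rw [smul_add, pow_add, mul_smul, mul_smul, hn', smul_zero, smul_comm, hn,
          smul_zero, add_zero]⟩
      zero_mem' := ⟨0, smul_zero _⟩
      smul_mem' := by
        rintro r q ⟨n, hn⟩
        exact ⟨n, by rw [smul_comm, hn, smul_zero]⟩ }
  have hT : Module.Baer R T := Baer.powTorsion hB x T fun q => Iff.rfl
  let res : Dual R B E →ₗ[R] Dual R T E := LinearMap.lcomp R E T.subtype
  have hres : Function.Surjective res := fun a => by
    obtain ⟨a', ha'⟩ := Baer.exists_extend hε.baer T a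
    exact ⟨a', LinearMap.ext fun q => ha' q q.2⟩
  have hsurj : Function.Surjective (eval R T E) := by
    -- a multiple of `g` becomes an evaluation in `B°°`, necessarily at an element of `T`
    refine hε.eval_surjective_of_powTorsion hT hx (fun ⟨q, n, hn⟩ => ⟨n, Subtype.ext hn⟩)
      fun g => ?_
    obtain ⟨r, hr, q, hq⟩ := htors (g ∘ₗ res)
    have hqT : q ∈ T := by
      by_contra hqT
      obtain ⟨a, haT, ha⟩ := hε.exists_apply_eq_of_notMem hqT
      have h0 : res a = 0 := LinearMap.ext fun y => haT y y.2
      apply hε.ne_zero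
      rw [← ha, ← eval_apply q a, hq, LinearMap.smul_apply, LinearMap.comp_apply, h0, map_zero,
        smul_zero]
    obtain ⟨n, hn⟩ := hqT
    refine ⟨x ^ n * r, mul_ne_zero (pow_ne_zero n hx) hr, LinearMap.ext fun a => ?_⟩
    obtain ⟨a, rfl⟩ := hres a
    have h1 : r • g (res a) = a q := (LinearMap.congr_fun hq a).symm
    rw [LinearMap.smul_apply, mul_smul, h1, ← map_smul, hn, map_zero, LinearMap.zero_apply]
  -- a functional that vanishes on `T` is divisible by `x`, so `f` kills it
  obtain ⟨g, hg⟩ := Baer.exists_comp_eq hε.baer res f fun a ha => by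
    obtain ⟨a', rfl⟩ := exists_smul_eq_of_vanish (fun r hr b => Baer.exists_smul_eq hB hr b) hx a
      fun q hq => LinearMap.congr_fun (LinearMap.mem_ker.mp ha) ⟨q, 1, by rwa [pow_one]⟩
    rw [LinearMap.mem_ker, map_smul, ← LinearMap.smul_apply, hxf, LinearMap.zero_apply]
  obtain ⟨q, rfl⟩ := hsurj g
  have hfq : f = eval R B E q := by
    rw [← hg]
    rfl
  rw [hfq, hρ] at hf
  rw [hfq, hf, map_zero]

end FiniteRank

/-! ### Ranks -/

section Rank

open Cardinal

/-- The rank over the domain agrees with `Module.rank`, up to a universe lift. -/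
theorem rank_eq_lift {R : Type u} [CommRing R] [IsDomain R] (M : Type v) [AddCommGroup M]
    [Module R M] : rank R M = Cardinal.lift.{u} (Module.rank R M) := by
  have h := IsLocalizedModule.lift_rank_eq (nonZeroDivisors R)
    (TensorProduct.mk R (FractionRing R) M 1) le_rfl
  rw [rank, IsFractionRing.rank_right_eq R]
  rwa [Cardinal.lift_id'.{v, u}, Cardinal.lift_umax.{v, u}] at h

theorem lift_rank_eq_iff {R : Type u} [CommRing R] [IsDomain R] {M : Type v} [AddCommGroup M]
    [Module R M] {N : Type (max v w)} [AddCommGroup N] [Module R N] :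
    Cardinal.lift.{w} (rank R M) = rank R N ↔
      Cardinal.lift.{w} (Module.rank R M) = Module.rank R N := by
  rw [rank_eq_lift, rank_eq_lift, Cardinal.lift_lift,
    ← Cardinal.lift_inj.{_, u} (b := Module.rank R N), Cardinal.lift_lift]

/-- An injective map between modules of the same finite rank has a torsion cokernel. -/
theorem exists_smul_mem_range_of_rank_eq {R : Type u} [CommRing R] [IsDomain R] {M : Type v}
    [AddCommGroup M] [Module R M] {N : Type (max v w)} [AddCommGroup N] [Module R N]
    (φ : M →ₗ[R] N) (hφ : Function.Injective φ) (hfin : Module.rank R M < ℵ₀)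
    (h : Cardinal.lift.{w} (Module.rank R M) = Module.rank R N) (n : N) :
    ∃ r : R, r ≠ 0 ∧ ∃ m, φ m = r • n := by
  have h1 : Cardinal.lift.{w} (Module.rank R M) = Module.rank R (LinearMap.range φ) := by
    have := (LinearEquiv.ofInjective φ hφ).lift_rank_eq
    rwa [Cardinal.lift_id'.{v, w}, Cardinal.lift_umax.{v, w}] at this
  have h2 := rank_quotient_add_rank_of_isDomain (LinearMap.range φ)
  rw [← h1, ← h] at h2
  have h3 : Module.rank R (N ⧸ LinearMap.range φ) = 0 :=
    Cardinal.eq_of_add_eq_add_right (b := Cardinal.lift.{w} (Module.rank R M))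
      (by rw [h2, zero_add]) (by simpa using hfin)
  obtain ⟨r, hr, hrn⟩ := rank_eq_zero_iff.mp h3 (Submodule.Quotient.mk n)
  rw [← Submodule.Quotient.mk_smul, Submodule.Quotient.mk_eq_zero] at hrn
  exact ⟨r, hr, hrn⟩

end Rank


section InfiniteRank

open Cardinal

/-- For a vector space `V` over the field of fractions `K` with basis `b : ι → V`, the functionals
`V → K` followed by a nonzero map `K → E` embed `ι → K` into the dual of `V`. -/
theorem IsSocleGenerator.exists_injective_dual {R : Type*} [CommRing R] [IsDomain R]
    [IsLocalRing R] {E : Type*} [AddCommGroup E] [Module R E] {ε : E} (hε : IsSocleGenerator R ε)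
    {V : Type*} [AddCommGroup V] [Module R V] [Module (FractionRing R) V]
    [IsScalarTower R (FractionRing R) V] {ι : Type*} (b : Module.Basis ι (FractionRing R) V) :
    ∃ Φ : (ι → FractionRing R) →ₗ[R] Dual R V E, Function.Injective Φ := by
  obtain ⟨φ, hφ⟩ := hε.exists_apply_eq (N := FractionRing R) one_ne_zero
  let Φ : (ι → FractionRing R) →ₗ[R] Dual R V E :=
    { toFun := fun c => φ ∘ₗ (b.constr (FractionRing R) c).restrictScalars R
      map_add' := fun c d => by
        ext x
        simp
      map_smul' := fun r c => by
        ext x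
        have : b.constr (FractionRing R) (r • c) x = r • b.constr (FractionRing R) c x := by
          rw [← algebraMap_smul (FractionRing R) r c, map_smul, LinearMap.smul_apply,
            algebraMap_smul]
        simp [this] }
  refine ⟨Φ, (injective_iff_map_eq_zero _).mpr fun c hc => funext fun i => ?_⟩
  by_contra h
  apply hε.ne_zero
  have h1 : φ (b.constr (FractionRing R) c ((c i)⁻¹ • b i)) = 0 :=
    LinearMap.congr_fun hc ((c i)⁻¹ • b i)
  rw [map_smul, Module.Basis.constr_basis, smul_eq_mul, inv_mul_cancel₀ h] at h1
  rw [← hφ, h1]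

/-- A divisible module of infinite rank has smaller rank than its bidual, by the Erdős–Kaplansky
theorem on the dimension of `ι → K`. -/
theorem IsSocleGenerator.lift_rank_lt_rank_bidual {R : Type u} [CommRing R] [IsDomain R]
    [IsLocalRing R] {E : Type w} [AddCommGroup E] [Module R E] {ε : E}
    (hε : IsSocleGenerator R ε) {M : Type v} [AddCommGroup M] [Module R M]
    (hdiv : ∀ r : R, r ≠ 0 → ∀ b : M, ∃ b', r • b' = b) (hinf : ℵ₀ ≤ rank R M) :
    Cardinal.lift.{w} (rank R M) < rank R (Dual R (Dual R M E) E) := by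
  let K := FractionRing R
  let V := K ⊗[R] M
  let b := Module.Basis.ofVectorSpace K V
  set ι := Module.Basis.ofVectorSpaceIndex K V
  have hι : #ι = rank R M := b.mk_eq_rank''
  let U := ι → K
  let b' := Module.Basis.ofVectorSpace K U
  set ι' := Module.Basis.ofVectorSpaceIndex K U
  have hinfι : Infinite ι := aleph0_le_mk_iff.mp (hι ▸ hinf)
  have hι' : #ι ≤ #ι' := by
    classical
    rw [b'.mk_eq_rank'', rank_fun_infinite]
    refine mk_le_of_injective (f := fun i => (Pi.single i 1 : ι → K)) fun i i' h => ?_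
    by_contra hne
    have := congr_fun h i
    simp only [Pi.single_eq_same, Pi.single_eq_of_ne hne] at this
    exact one_ne_zero this
  have hinfι' : Infinite ι' := aleph0_le_mk_iff.mp ((hι ▸ hinf).trans hι')
  have hlt : #ι' < Module.rank R (ι' → K) := by
    classical
    rw [← IsFractionRing.rank_right_eq R K, rank_fun_infinite]
    refine (cantor #ι').trans_le ?_
    rw [← mk_set]
    refine mk_le_of_injective (f := fun s : Set ι' => fun i => if i ∈ s then (1 : K) else 0)
      fun s s' h => Set.ext fun i => ?_
    have := congr_fun h i
    by_cases hs : i ∈ s <;> by_cases hs' : i ∈ s' <;> simp_all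
  obtain ⟨Φ, hΦ⟩ := hε.exists_injective_dual b
  obtain ⟨Φ', hΦ'⟩ := hε.exists_injective_dual b'
  -- as `M` is divisible, it maps onto `V`
  have hq : Function.Surjective (TensorProduct.mk R K M 1) := by
    intro x
    induction x using TensorProduct.induction_on with
    | zero => exact ⟨0, map_zero _⟩
    | add x y hx hy =>
      obtain ⟨m, rfl⟩ := hx
      obtain ⟨m', rfl⟩ := hy
      exact ⟨m + m', map_add _ _ _⟩
    | tmul k m =>
      obtain ⟨p, s, hs, rfl⟩ := IsFractionRing.div_surjective (A := R) k
      obtain ⟨m', rfl⟩ := hdiv s (nonZeroDivisors.ne_zero hs) m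
      refine ⟨p • m', ?_⟩
      have hs0 : algebraMap R K s ≠ 0 := IsFractionRing.to_map_ne_zero_of_mem_nonZeroDivisors hs
      rw [TensorProduct.mk_apply, TensorProduct.tmul_smul, TensorProduct.tmul_smul,
        TensorProduct.smul_tmul', TensorProduct.smul_tmul', Algebra.smul_def, Algebra.smul_def,
        mul_one, mul_div_cancel₀ _ hs0]
  have h1 : Cardinal.lift.{max v w} (Module.rank R (Dual R U E)) ≤
      Cardinal.lift.{max u v w} (Module.rank R (Dual R (Dual R M E) E)) := by
    let j : U →ₗ[R] Dual R M E := LinearMap.lcomp R E (TensorProduct.mk R K M 1) ∘ₗ Φ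
    have hj : Function.Injective j := fun c d h => hΦ (LinearMap.ext fun x => by
      obtain ⟨m, rfl⟩ := hq x
      exact LinearMap.congr_fun h m)
    refine LinearMap.lift_rank_le_of_surjective (LinearMap.lcomp R E j) fun f => ?_
    obtain ⟨g, hg⟩ := hε.baer.extension_property j hj f
    exact ⟨g, hg⟩
  have h2 := LinearMap.lift_rank_le_of_injective Φ' hΦ'
  rw [Cardinal.lift_id'.{max v w, u}, Cardinal.lift_umax.{max v w, u}] at h1
  rw [Cardinal.lift_id'.{max u v, w}, Cardinal.lift_umax.{max u v, w}] at h2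
  rw [rank_eq_lift (Dual R (Dual R M E) E), ← hι]
  exact (Cardinal.lift_le.mpr hι').trans_lt
    ((Cardinal.lift_lt.mpr hlt).trans_le (h2.trans h1))

end InfiniteRank

end Matlis

theorem mainTheorem6 {R : Type u} [CommRing R] [IsDomain R] [IsLocalRing R]
    [IsNoetherianRing R]
    {E : Type w} [AddCommGroup E] [Module R E] [Small.{w} R]
    (ι : IsLocalRing.ResidueField R →ₗ[R] E) (hι : Matlis.IsInjectiveHull ι)
    {M : Type v} [AddCommGroup M] [Module R M] [Small.{v} R]
    (hM : Module.Injective R M)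
    (hrank : Cardinal.lift.{w} (Matlis.rank R M) =
      Matlis.rank R (Matlis.Dual R (Matlis.Dual R M E) E)) :
    Matlis.IsReflexive R M E := by
  have hε := hι.isSocleGenerator
  have hB : Module.Baer R M := Module.Baer.of_injective hM
  refine ⟨hε.eval_injective M, hε.eval_surjective_of_torsion_cokernel hB ?_⟩
  have hfin : Matlis.rank R M < Cardinal.aleph0 := by
    by_contra h
    exact (hε.lift_rank_lt_rank_bidual (fun r hr b => Matlis.Baer.exists_smul_eq hB hr b)
      (not_lt.mp h)).ne hrank
  refine Matlis.exists_smul_mem_range_of_rank_eq (Matlis.eval R M E) (hε.eval_injective M) ?_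
    (Matlis.lift_rank_eq_iff.mp hrank)
  rwa [Matlis.rank_eq_lift, Cardinal.lift_lt_aleph0] at hfin
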